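/- **Theorem (Finite-depth feasibility on the invariant sector).** Let $n\in\mathbb N$ and $m=n$. Consider $m$ blocks of $n$ qubits, each in the one-hot space $\mathcal H_1=\mathrm{span}\{|e_1\rangle,\dots,|e_n\rangle\}$, and let $\mathcal H_{\mathrm{OH}}=\mathcal H_1^{\otimes m}$ with orthonormal basis $|x\rangle=|e_{x_1}\rangle\otimes\cdots\otimes|e_{x_m}\rangle$, $x\in[n]^m$. Let $H_{\mathrm{pen}}$ be the operator on $\mathcal H_{\mathrm{OH}}$, diagonal in this basis, with $$H_{\mathrm{pen}}(x)=\sum_{k\in[n]}\bigl(N_k(x)-1\bigr)^2,\qquad N_k(x)=\#\{b: x_b=k\}.$$ Let $\widetilde H_M=\sum_{b=1}^m \widetilde H_M^{(b)}$ (restricted to $\mathcal H_{\mathrm{OH}}$), where $\widetilde H_M^{(b)}=\frac1n\sum_{j<k}\bigl(X^{(b)}_jX^{(b)}_k+Y^{(b)}_jY^{(b)}_k\bigr)$ acts on block $b$ through the Pauli operators of its $n$ qubits, and let $|s_0\rangle=\bigl(\tfrac1{\sqrt n}\sum_{k=1}^n|e_k\rangle\bigr)^{\otimes m}$. Let $G=S_m\times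 S_n$ act on $\mathcal H_{\mathrm{OH}}$ by permuting the blocks and by relabelling the symbols globally, that is, $U_{(\sigma,\tau)}|x\rangle=|\tau\circ x\circ\sigma^{-1}\rangle$. Let $\mathcal K_{\mathrm{inv}}=\{\psi\in\mathcal H_{\mathrm{OH}}: U_g\psi=\psi\ \ \forall g\in G\}$ and $d=\dim\mathcal K_{\mathrm{inv}}$. The operators $H_{\mathrm{pen}}$ and $\widetilde H_M$ preserve $\mathcal K_{\mathrm{inv}}$, and $|s_0\rangle\in\mathcal K_{\mathrm{inv}}$; put $A=H_{\mathrm{pen}}|_{\mathcal K_{\mathrm{inv}}}$ and $B=\widetilde H_M|_{\mathcal K_{\mathrm{inv}}}$. Assume that the real Lie algebra generated by $iA$ and $iB$ is $\mathfrak u(d)$, the Lie algebra of all skew-adjoint operators on $\mathcal K_{\mathrm{inv}}$. For $p\ge1$ and $\gamma,\beta\in\mathbb R^p$ let $$|\psi_p(\gamma,\beta)\rangle=\Bigl(\prod_{j=1}^p e^{-i\beta_jB}e^{-i\gamma_jA}\Bigr)|s_0\rangle,\qquad \pi_{\mathsf F}(p;\gamma,\beta)=\langle\psi_p(\gamma,\beta)|\,\Pi_0\,|\psi_p(\gamma,\beta)\rangle,$$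 where the layer $j=1$ acts first and $\Pi_0=\sum_{x:\,H_{\mathrm{pen}}(x)=0}|x\rangle\langle x|$. Then for every $\eta\in(0,1)$ there are a finite depth $p\ge 1$ and angles $\gamma,\beta\in\mathbb R^p$ such that $\pi_{\mathsf F}(p;\gamma,\beta)\ge1-\eta$. In particular, there are a finite depth $p\ge1$ and angles $\gamma,\beta\in\mathbb R^p$ such that $\pi_{\mathsf F}(p;\gamma,\beta)\ge\tfrac12$. -/

import Mathlib

namespace CEQAOA

noncomputable section

/-! ### One block: `n` qubits, Pauli operators and the one-hot space -/

/-- Pauli `X`. -/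
def pauliX : Matrix (Fin 2) (Fin 2) ℂ := !![0, 1; 1, 0]

/-- Pauli `Y`. -/
def pauliY : Matrix (Fin 2) (Fin 2) ℂ := !![0, -Complex.I; Complex.I, 0]

/-- The single-qubit operator `P` acting on qubit `j` of `n` qubits (identity elsewhere), in the
computational basis indexed by bit strings `Fin n → Fin 2`. -/
def onQubit {n : ℕ} (P : Matrix (Fin 2) (Fin 2) ℂ) (j : Fin n) :
    Matrix (Fin n → Fin 2) (Fin n → Fin 2) ℂ :=
  Matrix.of fun x y => if ∀ l, l ≠ j → x l = y l then P (x j) (y j) else 0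

/-- The normalized XY Hamiltonian `(1/n) ∑_{j<k} (X_j X_k + Y_j Y_k)` on the `n` qubits of one
block. -/
def xyHamiltonian (n : ℕ) : Matrix (Fin n → Fin 2) (Fin n → Fin 2) ℂ :=
  (1 / (n : ℂ)) • ∑ j : Fin n, ∑ k ∈ Finset.Ioi j,
    (onQubit pauliX j * onQubit pauliX k + onQubit pauliY j * onQubit pauliY k)

/-- The one-hot bit string `e_i`. -/
def oneHot {n : ℕ} (i : Fin n) : Fin n → Fin 2 := Pi.single i 1

/-- The restriction of the normalized XY Hamiltonian to the one-hot space
`H₁ = span {e_1, …, e_n}`, as a matrix in the basis `e_1, …, e_n`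
(`H₁` is invariant by `xyHamiltonian_oneHot_invariant`). -/
def blockMixer (n : ℕ) : Matrix (Fin n) (Fin n) ℂ :=
  (xyHamiltonian n).submatrix oneHot oneHot

/-! ### `m` blocks: the encoded space and its operators -/

/-- The encoded space `H_OH = H₁^{⊗ m}`: its orthonormal basis `e_{x_1} ⊗ ⋯ ⊗ e_{x_m}` is indexed
by the words `x : Fin m → Fin n`. -/
abbrev OneHotSpace (m n : ℕ) : Type := EuclideanSpace ℂ (Fin m → Fin n)

/-- The computational basis vector `|x⟩`. -/
def ket {m n : ℕ} (x : Fin m → Fin n) : OneHotSpace m n := EuclideanSpace.single x 1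

/-- The block-local mixer `∑_b 1 ⊗ ⋯ ⊗ H^{(b)} ⊗ ⋯ ⊗ 1`, in the basis `|x⟩`. -/
def mixerMatrix (m n : ℕ) : Matrix (Fin m → Fin n) (Fin m → Fin n) ℂ :=
  Matrix.of fun x y => ∑ b : Fin m,
    if ∀ b', b' ≠ b → x b' = y b' then blockMixer n (x b) (y b) else 0

/-- The mixer Hamiltonian on the encoded space. -/
def mixer (m n : ℕ) : OneHotSpace m n →L[ℂ] OneHotSpace m n :=
  Matrix.toEuclideanCLM (𝕜 := ℂ) (mixerMatrix m n)

/-- `N_k(x) = #{b : x_b = k}`. -/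
def count {m n : ℕ} (x : Fin m → Fin n) (k : Fin n) : ℕ :=
  (Finset.univ.filter fun b => x b = k).card

/-- The permutation penalty `∑_k (N_k(x) - 1)²`. -/
def penalty {m n : ℕ} (x : Fin m → Fin n) : ℤ := ∑ k : Fin n, ((count x k : ℤ) - 1) ^ 2

/-- The penalty Hamiltonian, diagonal in the computational basis. -/
def penaltyHamiltonian (m n : ℕ) : OneHotSpace m n →L[ℂ] OneHotSpace m n :=
  Matrix.toEuclideanCLM (𝕜 := ℂ) (Matrix.diagonal fun x => (penalty x : ℂ))

/-- The level-zero (feasible) words. -/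
def feasible (m n : ℕ) : Finset (Fin m → Fin n) := Finset.univ.filter fun x => penalty x = 0

/-- `Π₀ = ∑_{x feasible} |x⟩⟨x|`. -/
def feasibleProj (m n : ℕ) : OneHotSpace m n →L[ℂ] OneHotSpace m n :=
  ∑ x ∈ feasible m n, InnerProductSpace.rankOne ℂ (ket x) (ket x)

/-- The uniform one-hot product state: every block is in the state `(1/√n) ∑_k e_k`. -/
def initialState (m n : ℕ) : OneHotSpace m n :=
  WithLp.toLp 2 fun _ => ∏ _b : Fin m, (1 / (Real.sqrt n : ℂ))

/-! ### The symmetry group and the invariant sector -/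

/-- The unitary `U_g`, `g = (σ, τ) ∈ S_m × S_n`, with `U_g |x⟩ = |τ ∘ x ∘ σ⁻¹⟩`. -/
def symm {m n : ℕ} (g : Equiv.Perm (Fin m) × Equiv.Perm (Fin n)) :
    OneHotSpace m n ≃ₗᵢ[ℂ] OneHotSpace m n :=
  LinearIsometryEquiv.piLpCongrLeft 2 ℂ ℂ (g.1.arrowCongr g.2)

/-- The invariant sector `K_inv = Fix (S_m × S_n)`. -/
def invSector (m n : ℕ) : Submodule ℂ (OneHotSpace m n) where
  carrier := {ψ | ∀ g : Equiv.Perm (Fin m) × Equiv.Perm (Fin n), symm g ψ = ψ}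
  add_mem' := fun ha hb g => by rw [map_add, ha g, hb g]
  zero_mem' := fun g => map_zero _
  smul_mem' := fun c _ ha g => by rw [map_smul, ha g]

/-! ### Helper facts: the operators preserve the sector -/

lemma symm_apply {m n : ℕ} (g : Equiv.Perm (Fin m) × Equiv.Perm (Fin n)) (ψ : OneHotSpace m n)
    (x : Fin m → Fin n) : symm g ψ x = ψ ((g.1.arrowCongr g.2).symm x) := rfl

lemma symm_ket {m n : ℕ} (g : Equiv.Perm (Fin m) × Equiv.Perm (Fin n)) (x : Fin m → Fin n) :
    symm g (ket x) = ket (g.2 ∘ x ∘ g.1.symm) := by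
  have h : (g.1.arrowCongr g.2) x = g.2 ∘ x ∘ g.1.symm := rfl
  ext y
  rw [symm_apply, ket, ket, ← h]
  simp only [PiLp.single_apply]
  exact if_congr (Equiv.symm_apply_eq _) rfl rfl

lemma onQubit_mul_onQubit {n : ℕ} (P : Matrix (Fin 2) (Fin 2) ℂ) {j k : Fin n} (h : j ≠ k)
    (x y : Fin n → Fin 2) :
    (onQubit P j * onQubit P k) x y =
      if ∀ l, l ≠ j → l ≠ k → x l = y l then P (x j) (y j) * P (x k) (y k) else 0 := by
  classical
  rw [Matrix.mul_apply, Finset.sum_eq_single (Function.update x j (y j))]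
  · simp only [onQubit, Matrix.of_apply, Function.update_self, Function.update_of_ne h.symm]
    rw [if_pos (fun l hl => (Function.update_of_ne hl _ _).symm)]
    by_cases hc : ∀ l, l ≠ j → l ≠ k → x l = y l
    · rw [if_pos hc, if_pos]
      intro l hl
      by_cases hlj : l = j
      · subst hlj; simp
      · rw [Function.update_of_ne hlj]; exact hc l hlj hl
    · rw [if_neg hc, if_neg, mul_zero]
      intro hc'
      refine hc fun l hlj hlk => ?_
      have := hc' l hlk
      rwa [Function.update_of_ne hlj] at this
  · intro z _ hz
    simp only [onQubit, Matrix.of_apply]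
    by_cases h1 : ∀ l, l ≠ j → x l = z l
    · rw [if_neg (c := ∀ l, l ≠ k → z l = y l), mul_zero]
      intro h2
      refine hz (funext fun l => ?_)
      by_cases hlj : l = j
      · subst hlj; rw [Function.update_self]; exact h2 _ h
      · rw [Function.update_of_ne hlj]; exact (h1 l hlj).symm
    · rw [if_neg h1, zero_mul]
  · intro hx; exact absurd (Finset.mem_univ _) hx

lemma pauli_pair (a b c d : Fin 2) :
    pauliX a b * pauliX c d + pauliY a b * pauliY c d =
      if a ≠ c ∧ b ≠ d ∧ a ≠ b then 2 else 0 := by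
  fin_cases a <;> fin_cases b <;> fin_cases c <;> fin_cases d <;>
    norm_num [pauliX, pauliY]

/-- `X_j X_k + Y_j Y_k` exchanges the different bits `j`, `k`, with amplitude `2`. -/
lemma xy_pair_apply {n : ℕ} {j k : Fin n} (h : j ≠ k) (x y : Fin n → Fin 2) :
    (onQubit pauliX j * onQubit pauliX k + onQubit pauliY j * onQubit pauliY k) x y =
      if (∀ l, l ≠ j → l ≠ k → x l = y l) ∧ x j ≠ x k ∧ y j ≠ y k ∧ x j ≠ y j then 2 else 0 := by
  rw [Matrix.add_apply, onQubit_mul_onQubit _ h, onQubit_mul_onQubit _ h]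
  by_cases hc : ∀ l, l ≠ j → l ≠ k → x l = y l
  · rw [if_pos hc, if_pos hc, pauli_pair]
    exact if_congr (and_iff_right hc).symm rfl rfl
  · rw [if_neg hc, if_neg hc, add_zero, if_neg fun h => hc h.1]

lemma oneHot_apply {n : ℕ} (i l : Fin n) : oneHot i l = if l = i then 1 else 0 := by
  simp [oneHot, Pi.single_apply]

/-- On the one-hot space the normalized XY Hamiltonian is `2/n` times the adjacency matrix of the
complete graph. -/
lemma blockMixer_apply {n : ℕ} (i l : Fin n) :
    blockMixer n i l = if i = l then 0 else 2 / (n : ℂ) := by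
  have key : ∀ j k : Fin n, j < k →
      (onQubit pauliX j * onQubit pauliX k + onQubit pauliY j * onQubit pauliY k)
        (oneHot i) (oneHot l) = if (j = i ∧ k = l) ∨ (j = l ∧ k = i) then 2 else 0 := by
    intro j k hjk
    rw [xy_pair_apply hjk.ne]
    refine if_congr ?_ rfl rfl
    simp only [oneHot_apply]
    constructor
    · rintro ⟨-, h2, h3, h4⟩
      have := hjk.ne
      split_ifs at h2 h3 h4 <;> simp_all
    · rintro (⟨rfl, rfl⟩ | ⟨rfl, rfl⟩) <;> simp [hjk.ne, hjk.ne'] <;>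
        (intro a h1 h2; simp [h1, h2])
  simp only [blockMixer, Matrix.submatrix_apply, xyHamiltonian, Matrix.smul_apply,
    Matrix.sum_apply, smul_eq_mul]
  rw [Finset.sum_congr rfl fun j _ => Finset.sum_congr rfl fun k hk =>
    key j k (Finset.mem_Ioi.1 hk)]
  rcases lt_trichotomy i l with h | h | h
  · rw [if_neg h.ne, Finset.sum_eq_single i, Finset.sum_eq_single l]
    · simp; ring
    · intro k _ hk; simp [hk, h.ne]
    · intro hl; simp [h] at hl
    · intro j _ hj
      refine Finset.sum_eq_zero fun k hk => if_neg ?_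
      rintro (⟨rfl, rfl⟩ | ⟨rfl, rfl⟩)
      · exact hj rfl
      · exact absurd (Finset.mem_Ioi.1 hk) (not_lt.2 h.le)
    · simp
  · subst h
    rw [if_pos rfl, Finset.sum_eq_zero, mul_zero]
    intro j _
    refine Finset.sum_eq_zero fun k hk => if_neg ?_
    have := (Finset.mem_Ioi.1 hk).ne
    rintro (⟨rfl, rfl⟩ | ⟨rfl, rfl⟩) <;> exact this rfl
  · rw [if_neg h.ne', Finset.sum_eq_single l, Finset.sum_eq_single i]
    · simp; ring
    · intro k _ hk; simp [hk, h.ne]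
    · intro hl; simp [h] at hl
    · intro j _ hj
      refine Finset.sum_eq_zero fun k hk => if_neg ?_
      rintro (⟨rfl, rfl⟩ | ⟨rfl, rfl⟩)
      · exact absurd (Finset.mem_Ioi.1 hk) (not_lt.2 h.le)
      · exact hj rfl
    · simp

/-- The XY Hamiltonian maps the one-hot space into itself. -/
lemma xyHamiltonian_oneHot_invariant {n : ℕ} (i : Fin n) (x : Fin n → Fin 2)
    (hx : x ∉ Set.range (oneHot (n := n))) : xyHamiltonian n x (oneHot i) = 0 := by
  simp only [xyHamiltonian, Matrix.smul_apply, Matrix.sum_apply, smul_eq_mul]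
  rw [Finset.sum_eq_zero, mul_zero]
  intro j _
  refine Finset.sum_eq_zero fun k hk => ?_
  have hjk : j < k := Finset.mem_Ioi.1 hk
  rw [xy_pair_apply hjk.ne, if_neg]
  rintro ⟨h1, h2, h3, h4⟩
  simp only [oneHot_apply] at h1 h3 h4
  have hbit : ∀ a : Fin 2, a = 0 ∨ a = 1 := by decide
  by_cases hj : j = i
  · have hk' : k ≠ i := fun h => hjk.ne (hj.trans h.symm)
    refine hx ⟨k, funext fun l => ?_⟩
    rw [oneHot_apply]
    rcases hbit (x j) with hxj | hxj <;> rcases hbit (x k) with hxk | hxk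
    all_goals by_cases hlk : l = k
    all_goals by_cases hlj : l = j
    all_goals simp_all
  · refine hx ⟨j, funext fun l => ?_⟩
    rw [oneHot_apply]
    rcases hbit (x j) with hxj | hxj <;> rcases hbit (x k) with hxk | hxk
    all_goals by_cases hlk : l = k
    all_goals by_cases hlj : l = j
    all_goals simp_all

lemma symm_toEuclideanCLM {m n : ℕ} (g : Equiv.Perm (Fin m) × Equiv.Perm (Fin n))
    (M : Matrix (Fin m → Fin n) (Fin m → Fin n) ℂ)
    (hM : ∀ x y, M (g.1.arrowCongr g.2 x) (g.1.arrowCongr g.2 y) = M x y)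
    (ψ : OneHotSpace m n) :
    symm g (Matrix.toEuclideanCLM (𝕜 := ℂ) M ψ) =
      Matrix.toEuclideanCLM (𝕜 := ℂ) M (symm g ψ) := by
  ext x
  rw [symm_apply, Matrix.ofLp_toEuclideanCLM, Matrix.ofLp_toEuclideanCLM]
  simp only [Matrix.mulVec, dotProduct]
  refine Fintype.sum_equiv (g.1.arrowCongr g.2) _ _ fun y => ?_
  rw [symm_apply, Equiv.symm_apply_apply]
  congr 1
  conv_rhs => rw [← Equiv.apply_symm_apply (g.1.arrowCongr g.2) x]
  exact (hM _ _).symm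

lemma mixerMatrix_invariant {m n : ℕ} (g : Equiv.Perm (Fin m) × Equiv.Perm (Fin n))
    (x y : Fin m → Fin n) :
    mixerMatrix m n (g.1.arrowCongr g.2 x) (g.1.arrowCongr g.2 y) = mixerMatrix m n x y := by
  simp only [mixerMatrix, Matrix.of_apply, Equiv.arrowCongr_apply, Function.comp_apply,
    blockMixer_apply, EmbeddingLike.apply_eq_iff_eq]
  refine Fintype.sum_equiv g.1.symm _ _ fun b => if_congr ?_ rfl rfl
  constructor
  · intro h b' hb'
    have := h (g.1 b') (fun hb => hb' (by rw [← hb, Equiv.symm_apply_apply]))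
    rwa [Equiv.symm_apply_apply] at this
  · intro h b' hb'
    exact h _ (fun hb => hb' (g.1.symm.injective hb))

lemma penalty_invariant {m n : ℕ} (g : Equiv.Perm (Fin m) × Equiv.Perm (Fin n))
    (x : Fin m → Fin n) : penalty (g.1.arrowCongr g.2 x) = penalty x := by
  refine Fintype.sum_equiv g.2.symm _ _ fun k => ?_
  have : count (g.1.arrowCongr g.2 x) k = count x (g.2.symm k) := by
    refine Finset.card_equiv g.1.symm fun b => ?_
    simp [Equiv.arrowCongr_apply, Equiv.eq_symm_apply]
  rw [this]

lemma mixer_mem {m n : ℕ} : ∀ ψ ∈ invSector m n, mixer m n ψ ∈ invSector m n := by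
  intro ψ hψ g
  rw [mixer, symm_toEuclideanCLM g _ (mixerMatrix_invariant g), hψ g]

lemma penaltyHamiltonian_mem {m n : ℕ} :
    ∀ ψ ∈ invSector m n, penaltyHamiltonian m n ψ ∈ invSector m n := by
  intro ψ hψ g
  rw [penaltyHamiltonian, symm_toEuclideanCLM g, hψ g]
  intro x y
  simp only [Matrix.diagonal_apply, EmbeddingLike.apply_eq_iff_eq, penalty_invariant]

lemma initialState_mem (m n : ℕ) : initialState m n ∈ invSector m n := fun _ => rfl

instance instCompleteSpaceInvSector (m n : ℕ) : CompleteSpace (invSector m n) :=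
  FiniteDimensional.complete ℂ _

/-! ### The restricted dynamics -/

/-- `A`: the penalty Hamiltonian restricted to the invariant sector. -/
def opA (m n : ℕ) : invSector m n →L[ℂ] invSector m n :=
  (penaltyHamiltonian m n).restrict penaltyHamiltonian_mem

/-- `B`: the mixer restricted to the invariant sector. -/
def opB (m n : ℕ) : invSector m n →L[ℂ] invSector m n :=
  (mixer m n).restrict mixer_mem

attribute [local instance] LieRing.ofAssociativeRing in
/-- The real Lie algebra generated by `iA` and `iB` (for the commutator bracket) is the Lie algebra
`u(d)` of all skew-adjoint operators on the given (`d`-dimensional) Hilbert space. -/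
def LieGeneratesUnitary {E : Type*} [NormedAddCommGroup E] [InnerProductSpace ℂ E]
    [CompleteSpace E] (A B : E →L[ℂ] E) : Prop :=
  (LieSubalgebra.lieSpan ℝ (E →L[ℂ] E) {Complex.I • A, Complex.I • B} : Set (E →L[ℂ] E)) =
    (skewAdjoint (E →L[ℂ] E) : Set (E →L[ℂ] E))

/-- The alternating product of layers `e^{-iβ_jB} e^{-iγ_jA}`; layer `0` acts first (so it is the
rightmost factor). -/
def alternating {E : Type*} [NormedAddCommGroup E] [InnerProductSpace ℂ E] (A B : E →L[ℂ] E)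
    {p : ℕ} (γ β : Fin p → ℝ) : E →L[ℂ] E :=
  (List.ofFn fun j =>
    NormedSpace.exp ((-(Complex.I * (β j : ℂ))) • B) *
      NormedSpace.exp ((-(Complex.I * (γ j : ℂ))) • A)).reverse.prod

/-- The state `U_p(γ, β) |s₀⟩`. -/
def finalState (m n : ℕ) {p : ℕ} (γ β : Fin p → ℝ) : OneHotSpace m n :=
  (alternating (opA m n) (opB m n) γ β ⟨initialState m n, initialState_mem m n⟩ : invSector m n)

/-- The feasibility probability `⟨ψ_p| Π₀ |ψ_p⟩` (a real number, since `Π₀` is self-adjoint). -/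
def feasProb (m n : ℕ) {p : ℕ} (γ β : Fin p → ℝ) : ℝ :=
  (inner ℂ (finalState m n γ β) (feasibleProj m n (finalState m n γ β))).re

end

end CEQAOA

/-! The closure of the set of alternating products is a closed submonoid `S` of the operators on the
invariant sector. The set of `X` with `exp (t • X) ∈ S` for all real `t` is closed under real
scaling, under sums (Lie–Trotter), under limits, and hence under brackets, since `[X, Y]` is the
velocity at `0` of the curve `exp (sX) Y exp (-sX)`, which stays in this set. It contains `iA` and
`iB`, so by hypothesis it contains every skew-adjoint operator
(`LieGeneratesUnitary.exp_mem_closure`).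

It remains to find one exponential taking `|s₀⟩` to a feasible state. The normalized sum of the
feasible words is invariant and has real overlap with `|s₀⟩`, so the reflection in the difference of
the two vectors exchanges them, and this reflection is `exp (iπP)` with `P` a rank-at-most-one
projection (`exists_skewAdjoint_exp_apply_eq`). The feasibility probability is continuous and equals
`1` at the target, so some alternating product brings it above any `c < 1`. -/

namespace CEQAOA

/-! ### One-parameter semigroups in a closed submonoid of a Banach algebra. -/

section OneParameter

open Filter Topology NormedSpace

variable {𝔸 : Type*} [NormedRing 𝔸]

/-- Telescoping, by induction on the exponent. Assuming `‖1‖ ≤ 1` instead of `‖1‖ = 1` admits the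
operators on the zero space. -/
lemma norm_pow_sub_pow_le (hone : ‖(1 : 𝔸)‖ ≤ 1) {a b : 𝔸} {M : ℝ} (hM : 1 ≤ M) (ha : ‖a‖ ≤ M)
    (hb : ‖b‖ ≤ M) (n : ℕ) : ‖a ^ n - b ^ n‖ ≤ n * M ^ n * ‖a - b‖ := by
  have hpow : ∀ k : ℕ, ‖b ^ k‖ ≤ M ^ k := fun k => by
    rcases Nat.eq_zero_or_pos k with rfl | hk
    · simpa using hone
    · exact (norm_pow_le' b hk).trans (pow_le_pow_left₀ (norm_nonneg _) hb _)
  induction n with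
  | zero => simp
  | succ n ih =>
    have hM0 : 0 ≤ M := zero_le_one.trans hM
    have h : a ^ (n + 1) - b ^ (n + 1) = a * (a ^ n - b ^ n) + (a - b) * b ^ n := by
      rw [pow_succ' a, pow_succ' b]; noncomm_ring
    rw [h]
    calc ‖a * (a ^ n - b ^ n) + (a - b) * b ^ n‖
        ≤ ‖a‖ * ‖a ^ n - b ^ n‖ + ‖a - b‖ * ‖b ^ n‖ :=
          (norm_add_le _ _).trans (add_le_add (norm_mul_le _ _) (norm_mul_le _ _))
      _ ≤ M * (n * M ^ n * ‖a - b‖) + ‖a - b‖ * (M ^ n * M) := by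
          gcongr
          exact (hpow n).trans (le_mul_of_one_le_right (pow_nonneg hM0 _) hM)
      _ = ((n + 1 : ℕ) : ℝ) * M ^ (n + 1) * ‖a - b‖ := by push_cast; ring

variable [NormedAlgebra ℝ 𝔸]

lemma tendsto_natCast_smul_sub_of_hasDerivAt {F : ℝ → 𝔸} {Z : 𝔸} (hF : HasDerivAt F Z 0) :
    Tendsto (fun n : ℕ => (n : ℝ) • (F (n : ℝ)⁻¹ - F 0)) atTop (𝓝 Z) := by
  have h : Tendsto (fun n : ℕ => (n : ℝ)⁻¹) atTop (𝓝[≠] 0) :=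
    (tendsto_inv_atTop_nhdsGT_zero.comp tendsto_natCast_atTop_atTop).mono_right
      (nhdsWithin_mono _ fun x hx => ne_of_gt hx)
  simpa [Function.comp_def] using hF.tendsto_slope_zero.comp h

/-- Two curves through `1` with the same velocity have asymptotically equal powers. -/
lemma tendsto_pow_sub_pow_of_hasDerivAt (hone : ‖(1 : 𝔸)‖ ≤ 1) {F H : ℝ → 𝔸} {Z : 𝔸}
    (hF : HasDerivAt F Z 0) (hH : HasDerivAt H Z 0) (hF1 : F 0 = 1) (hH1 : H 0 = 1) :
    Tendsto (fun n : ℕ => F (n : ℝ)⁻¹ ^ n - H (n : ℝ)⁻¹ ^ n) atTop (𝓝 0) := by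
  -- With this bound the `n`-th powers of the norms stay below `exp (‖Z‖ + 1)`, uniformly in `n`;
  -- the remaining factor `n * ‖F - H‖` tends to `0` because the velocities agree.
  have key : ∀ G : ℝ → 𝔸, HasDerivAt G Z 0 → G 0 = 1 →
      ∀ᶠ n : ℕ in atTop, 0 < n → ‖G (n : ℝ)⁻¹‖ ≤ 1 + (‖Z‖ + 1) / n := by
    intro G hG hG1
    have h := (tendsto_natCast_smul_sub_of_hasDerivAt hG).norm.eventually
      (gt_mem_nhds (lt_add_one ‖Z‖))
    filter_upwards [h] with n hn hpos
    have hn0 : (0 : ℝ) < n := Nat.cast_pos.2 hpos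
    rw [norm_smul, Real.norm_natCast, hG1] at hn
    have h1 : ‖G (n : ℝ)⁻¹ - 1‖ ≤ (‖Z‖ + 1) / n := by
      rw [le_div_iff₀ hn0, mul_comm]; exact hn.le
    calc ‖G (n : ℝ)⁻¹‖ = ‖1 + (G (n : ℝ)⁻¹ - 1)‖ := by rw [add_sub_cancel]
      _ ≤ _ := (norm_add_le _ _).trans (add_le_add hone h1)
  have hd : Tendsto (fun n : ℕ => Real.exp (‖Z‖ + 1) *
      ‖(n : ℝ) • (F (n : ℝ)⁻¹ - H (n : ℝ)⁻¹)‖) atTop (𝓝 0) := by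
    have h := ((tendsto_natCast_smul_sub_of_hasDerivAt hF).sub
      (tendsto_natCast_smul_sub_of_hasDerivAt hH)).norm.const_mul (Real.exp (‖Z‖ + 1))
    simpa [← smul_sub, hF1, hH1] using h
  refine squeeze_zero_norm' ?_ hd
  filter_upwards [key F hF hF1, key H hH hH1, eventually_gt_atTop 0] with n h1 h2 hpos
  have hn0 : (0 : ℝ) < n := Nat.cast_pos.2 hpos
  have hc : 0 ≤ (‖Z‖ + 1) / n := by positivity
  refine (norm_pow_sub_pow_le hone (le_add_of_nonneg_right hc) (h1 hpos) (h2 hpos) n).trans ?_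
  have h3 : (1 + (‖Z‖ + 1) / n) ^ n ≤ Real.exp (‖Z‖ + 1) := by
    calc (1 + (‖Z‖ + 1) / n) ^ n ≤ Real.exp ((‖Z‖ + 1) / n) ^ n := by
          gcongr; rw [add_comm]; exact Real.add_one_le_exp _
      _ = Real.exp (‖Z‖ + 1) := by
          rw [← Real.exp_nat_mul]; congr 1; field_simp
  rw [norm_smul, Real.norm_natCast]
  calc _ = (1 + (‖Z‖ + 1) / n) ^ n * (n * ‖F (n : ℝ)⁻¹ - H (n : ℝ)⁻¹‖) := by ring
    _ ≤ _ := by gcongr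

/-- The generators of the one-parameter semigroups contained in `S`. -/
def oneParameterGenerators (S : Submonoid 𝔸) : Set 𝔸 := {X | ∀ t : ℝ, exp (t • X) ∈ S}

variable {S : Submonoid 𝔸}

lemma smul_mem_oneParameterGenerators {X : 𝔸} (hX : X ∈ oneParameterGenerators S) (c : ℝ) :
    c • X ∈ oneParameterGenerators S := fun t => by rw [smul_smul]; exact hX _

variable [CompleteSpace 𝔸]

lemma exp_inv_natCast_smul_pow (X : 𝔸) {n : ℕ} (hn : 0 < n) :
    exp ((n : ℝ)⁻¹ • X) ^ n = exp X := by
  let _ : NormedAlgebra ℚ 𝔸 := NormedAlgebra.restrictScalars ℚ ℝ 𝔸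
  rw [← exp_nsmul, ← Nat.cast_smul_eq_nsmul ℝ, smul_smul,
    mul_inv_cancel₀ (Nat.cast_ne_zero.2 hn.ne'), one_smul]

lemma hasDerivAt_exp_smul_zero (X : 𝔸) : HasDerivAt (fun t : ℝ => exp (t • X)) X 0 := by
  simpa using hasDerivAt_exp_smul_const (𝕂 := ℝ) X 0

/-- The Lie–Trotter product formula. -/
lemma tendsto_exp_mul_exp_pow (hone : ‖(1 : 𝔸)‖ ≤ 1) (X Y : 𝔸) :
    Tendsto (fun n : ℕ => (exp ((n : ℝ)⁻¹ • X) * exp ((n : ℝ)⁻¹ • Y)) ^ n) atTop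
      (𝓝 (exp (X + Y))) := by
  have hF : HasDerivAt (fun t : ℝ => exp (t • X) * exp (t • Y)) (X + Y) 0 := by
    simpa using (hasDerivAt_exp_smul_zero X).fun_mul (hasDerivAt_exp_smul_zero Y)
  have h := tendsto_pow_sub_pow_of_hasDerivAt hone hF (hasDerivAt_exp_smul_zero (X + Y))
    (by simp) (by simp)
  rw [← tendsto_sub_nhds_zero_iff]
  refine h.congr' ?_
  filter_upwards [eventually_gt_atTop 0] with n hn
  rw [exp_inv_natCast_smul_pow _ hn]

lemma add_mem_oneParameterGenerators (hone : ‖(1 : 𝔸)‖ ≤ 1) (hS : IsClosed (S : Set 𝔸)) {X Y : 𝔸}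
    (hX : X ∈ oneParameterGenerators S) (hY : Y ∈ oneParameterGenerators S) :
    X + Y ∈ oneParameterGenerators S := fun t => by
  rw [smul_add]
  refine hS.mem_of_tendsto (tendsto_exp_mul_exp_pow hone (t • X) (t • Y))
    (Eventually.of_forall fun n => ?_)
  exact S.pow_mem (S.mul_mem (smul_mem_oneParameterGenerators hX t _)
    (smul_mem_oneParameterGenerators hY t _)) n

lemma isClosed_oneParameterGenerators (hS : IsClosed (S : Set 𝔸)) :
    IsClosed (oneParameterGenerators S) := by
  let _ : NormedAlgebra ℚ 𝔸 := NormedAlgebra.restrictScalars ℚ ℝ 𝔸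
  simp only [oneParameterGenerators, Set.ofPred_forall]
  exact isClosed_iInter fun t => hS.preimage (exp_continuous.comp (continuous_const_smul t))

/-- Exponentiation commutes with conjugation by the unit `exp X`, and both `exp X` and its inverse
`exp (-X)` lie in `S` because `t` may be negative. -/
lemma conj_mem_oneParameterGenerators {X Y : 𝔸} (hX : X ∈ oneParameterGenerators S)
    (hY : Y ∈ oneParameterGenerators S) :
    exp X * Y * exp (-X) ∈ oneParameterGenerators S := fun t => by
  let _ : NormedAlgebra ℚ 𝔸 := NormedAlgebra.restrictScalars ℚ ℝ 𝔸
  have h1 : exp X * exp (-X) = 1 := by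
    rw [← exp_add_of_commute (Commute.neg_right (Commute.refl X)), add_neg_cancel, exp_zero]
  have h2 : exp (-X) * exp X = 1 := by
    rw [← exp_add_of_commute (Commute.neg_left (Commute.refl X)), neg_add_cancel, exp_zero]
  let u : 𝔸ˣ := ⟨exp X, exp (-X), h1, h2⟩
  have h : t • (exp X * Y * exp (-X)) = (u : 𝔸) * (t • Y) * (↑u⁻¹ : 𝔸) := by
    rw [mul_smul_comm, smul_mul_assoc]; rfl
  rw [h, exp_units_conj]
  refine S.mul_mem (S.mul_mem ?_ (hY t)) ?_
  · simpa using hX 1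
  · change exp (-X) ∈ S
    simpa using hX (-1)

/-- The commutator is a limit of difference quotients of `exp (sX) Y exp (-sX)`, each a real
combination of generators. -/
lemma mul_sub_mul_mem_oneParameterGenerators (hone : ‖(1 : 𝔸)‖ ≤ 1) (hS : IsClosed (S : Set 𝔸))
    {X Y : 𝔸} (hX : X ∈ oneParameterGenerators S) (hY : Y ∈ oneParameterGenerators S) :
    X * Y - Y * X ∈ oneParameterGenerators S := by
  have hd : HasDerivAt (fun s : ℝ => exp (s • X) * Y * exp (s • -X)) (X * Y - Y * X) 0 := by
    have h := ((hasDerivAt_exp_smul_zero X).mul_const Y).fun_mul (hasDerivAt_exp_smul_zero (-X))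
    simpa [sub_eq_add_neg] using h
  refine (isClosed_oneParameterGenerators hS).mem_of_tendsto
    (tendsto_natCast_smul_sub_of_hasDerivAt hd) (Eventually.of_forall fun n => ?_)
  refine smul_mem_oneParameterGenerators ?_ _
  rw [sub_eq_add_neg]
  refine add_mem_oneParameterGenerators hone hS ?_ ?_
  · simpa using conj_mem_oneParameterGenerators (smul_mem_oneParameterGenerators hX _) hY
  · simpa using smul_mem_oneParameterGenerators hY (-1)

end OneParameter

/-! ### Density of the alternating products and steering of vectors. -/

section Controllability

open NormedSpace

variable {E : Type*} [NormedAddCommGroup E] [InnerProductSpace ℂ E]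

/-- The alternating products of all depths. -/
def alternatingSubmonoid (A B : E →L[ℂ] E) : Submonoid (E →L[ℂ] E) where
  carrier := {M | ∃ (p : ℕ) (γ β : Fin p → ℝ), alternating A B γ β = M}
  one_mem' := ⟨0, Fin.elim0, Fin.elim0, by simp [alternating]⟩
  mul_mem' := by
    rintro _ _ ⟨p, γ, β, rfl⟩ ⟨q, γ', β', rfl⟩
    -- The right factor acts first, so its angles come first.
    refine ⟨q + p, Fin.append γ' γ, Fin.append β' β, ?_⟩
    unfold alternating
    rw [← List.prod_append, ← List.reverse_append, ← List.ofFn_fin_append]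
    congr 3
    funext j
    refine Fin.addCases (fun i => ?_) (fun i => ?_) j <;> simp

lemma alternating_append_zero (A B : E →L[ℂ] E) {p : ℕ} (γ β : Fin p → ℝ) :
    alternating A B (Fin.snoc γ 0 : Fin (p + 1) → ℝ) (Fin.snoc β 0 : Fin (p + 1) → ℝ) =
      alternating A B γ β := by
  unfold alternating
  rw [List.ofFn_succ']
  simp

lemma exp_smul_left_mem_alternatingSubmonoid (A B : E →L[ℂ] E) (t : ℝ) :
    exp (t • (Complex.I • A)) ∈ alternatingSubmonoid A B := by
  -- The sign cancels the one in the layer `e^{-iγA}`; the zero angle makes the other factor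
  -- trivial.
  refine ⟨1, fun _ => -t, fun _ => 0, ?_⟩
  have : t • (Complex.I • A) = (Complex.I * (t : ℂ)) • A := by
    rw [mul_comm, mul_smul, Complex.coe_smul]
  simp [alternating, this]

lemma exp_smul_right_mem_alternatingSubmonoid (A B : E →L[ℂ] E) (t : ℝ) :
    exp (t • (Complex.I • B)) ∈ alternatingSubmonoid A B := by
  refine ⟨1, fun _ => 0, fun _ => -t, ?_⟩
  have : t • (Complex.I • B) = (Complex.I * (t : ℂ)) • B := by
    rw [mul_comm, mul_smul, Complex.coe_smul]
  simp [alternating, this]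

variable [CompleteSpace E]

attribute [local instance] LieRing.ofAssociativeRing in
/-- Under the Lie algebra rank condition, the alternating products are dense in the exponentials of
skew-adjoint operators. -/
lemma LieGeneratesUnitary.exp_mem_closure {A B : E →L[ℂ] E} (h : LieGeneratesUnitary A B)
    {X : E →L[ℂ] E} (hX : X ∈ skewAdjoint (E →L[ℂ] E)) :
    exp X ∈ (alternatingSubmonoid A B).topologicalClosure := by
  have hone : ‖(1 : E →L[ℂ] E)‖ ≤ 1 := ContinuousLinearMap.norm_id_le
  have hcl : IsClosed ((alternatingSubmonoid A B).topologicalClosure : Set (E →L[ℂ] E)) :=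
    Submonoid.isClosed_topologicalClosure _
  have hle := Submonoid.le_topologicalClosure (alternatingSubmonoid A B)
  have hX' : X ∈ LieSubalgebra.lieSpan ℝ (E →L[ℂ] E) {Complex.I • A, Complex.I • B} := by
    rw [← SetLike.mem_coe, h]; exact hX
  clear hX
  have key : X ∈ oneParameterGenerators (alternatingSubmonoid A B).topologicalClosure := by
    induction hX' using LieSubalgebra.lieSpan_induction with
    | mem x hx =>
      rcases hx with rfl | rfl
      · exact fun t => hle (exp_smul_left_mem_alternatingSubmonoid A B t)
      · exact fun t => hle (exp_smul_right_mem_alternatingSubmonoid A B t)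
    | zero => exact fun t => by rw [smul_zero, exp_zero]; exact one_mem _
    | add x y _ _ hx hy => exact add_mem_oneParameterGenerators hone hcl hx hy
    | smul a x _ hx => exact smul_mem_oneParameterGenerators hx a
    | lie x y _ _ hx hy => exact mul_sub_mul_mem_oneParameterGenerators hone hcl hx hy
  simpa using key 1

lemma exp_apply_of_apply_eq_smul {X : E →L[ℂ] E} {w : E} {μ : ℂ} (h : X w = μ • w) :
    exp X w = Complex.exp μ • w := by
  have hpow : ∀ n : ℕ, (X ^ n) w = μ ^ n • w := fun n => by
    induction n with
    | zero => simp
    | succ n ih => rw [pow_succ', mul_apply_eq_comp, ih, map_smul, h, smul_smul, pow_succ]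
  have h1 := (exp_series_hasSum_exp' (𝕂 := ℂ) X).mapL (ContinuousLinearMap.apply ℂ E w)
  have h2 := (exp_series_hasSum_exp' (𝕂 := ℂ) μ).smul_const w
  rw [Complex.exp_eq_exp_ℂ]
  refine h1.unique ?_
  convert h2 using 2 with n
  simp [hpow, smul_smul]

/-- Two vectors of equal norm with real inner product are exchanged by the exponential of a
skew-adjoint operator. -/
lemma exists_skewAdjoint_exp_apply_eq {u v : E} (hnorm : ‖u‖ = ‖v‖)
    (hreal : inner ℂ u v = inner ℂ v u) :
    ∃ X ∈ skewAdjoint (E →L[ℂ] E), exp X u = v := by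
  -- The operator `exp (iπP)` is the reflection `1 - 2P`: it negates `u - v` and fixes `u + v`,
  -- which is orthogonal to `u - v` by equality of norms and reality of the overlap.
  let P : E →L[ℂ] E := (ℂ ∙ (u - v)).starProjection
  refine ⟨(Real.pi * Complex.I) • P, ?_, ?_⟩
  · refine IsSelfAdjoint.smul_mem_skewAdjoint ?_ (isSelfAdjoint_starProjection _)
    rw [skewAdjoint.mem_iff]
    simp
  · have h1 : ((Real.pi * Complex.I) • P) (u - v) = (Real.pi * Complex.I) • (u - v) := by
      rw [smul_apply,
        Submodule.starProjection_eq_self_iff.2 (Submodule.mem_span_singleton_self _)]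
    have h2 : ((Real.pi * Complex.I) • P) (u + v) = (0 : ℂ) • (u + v) := by
      rw [smul_apply, (Submodule.starProjection_apply_eq_zero_iff _).2, smul_zero,
        zero_smul]
      rw [Submodule.mem_orthogonal_singleton_iff_inner_right, inner_sub_left, inner_add_right,
        inner_add_right, inner_self_eq_norm_sq_to_K, inner_self_eq_norm_sq_to_K, hnorm, hreal]
      ring
    have hu : u = (2 : ℂ)⁻¹ • ((u - v) + (u + v)) := by module
    conv_lhs => rw [hu]
    rw [map_smul, map_add, exp_apply_of_apply_eq_smul h1, exp_apply_of_apply_eq_smul h2,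
      Complex.exp_pi_mul_I, Complex.exp_zero]
    module

/-- Under the Lie algebra rank condition the alternating products of positive depth steer `u`
arbitrarily close to any `v` of the same norm with real overlap. -/
lemma LieGeneratesUnitary.exists_alternating_mem {A B : E →L[ℂ] E} (h : LieGeneratesUnitary A B)
    {u v : E} (hnorm : ‖u‖ = ‖v‖) (hreal : inner ℂ u v = inner ℂ v u) {O : Set E} (hO : IsOpen O)
    (hv : v ∈ O) :
    ∃ p : ℕ, 0 < p ∧ ∃ γ β : Fin p → ℝ, alternating A B γ β u ∈ O := by
  obtain ⟨X, hX, rfl⟩ := exists_skewAdjoint_exp_apply_eq hnorm hreal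
  obtain ⟨_, hM, p, γ, β, rfl⟩ := mem_closure_iff.1 (h.exp_mem_closure hX) _
    (hO.preimage (ContinuousLinearMap.apply ℂ E u).continuous) hv
  -- The approximating product may have depth `0`; a trivial extra layer makes the depth positive.
  refine ⟨p + 1, p.succ_pos, Fin.snoc γ 0, Fin.snoc β 0, ?_⟩
  rw [alternating_append_zero]
  exact hM

end Controllability

/-! ### The initial state and the feasible target in the invariant sector. -/

section Feasibility

variable {m n : ℕ}

lemma feasibleProj_apply (ψ : OneHotSpace m n) (x : Fin m → Fin n) :
    feasibleProj m n ψ x = if x ∈ feasible m n then ψ x else 0 := by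
  simp [feasibleProj, ket, EuclideanSpace.inner_single_left, Finset.sum_apply, Pi.single_apply]

/-- The hypothesis excludes `n = 0 < m`, where there are no words; for `m = n = 0` the single empty
word has amplitude `1`. -/
lemma norm_initialState (m n : ℕ) (h : n = 0 → m = 0) : ‖initialState m n‖ = 1 := by
  rw [EuclideanSpace.norm_eq, Real.sqrt_eq_one]
  simp only [initialState, Finset.prod_const, Finset.sum_const, Finset.card_univ, Fintype.card_pi,
    Fintype.card_fin, nsmul_eq_mul]
  rw [norm_pow, norm_div, norm_one, Complex.norm_real, Real.norm_of_nonneg (Real.sqrt_nonneg _),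
    ← pow_mul, mul_comm m 2, pow_mul, div_pow, one_pow, Real.sq_sqrt n.cast_nonneg]
  rcases Nat.eq_zero_or_pos n with hn | hn
  · simp [h hn]
  · have : (n : ℝ) ≠ 0 := Nat.cast_ne_zero.2 hn.ne'
    push_cast
    rw [← mul_pow, mul_one_div_cancel this, one_pow]

/-- The symmetric superposition of the feasible words. -/
def feasibleSum (m n : ℕ) : OneHotSpace m n :=
  WithLp.toLp 2 fun x => if x ∈ feasible m n then 1 else 0

lemma feasibleSum_mem (m n : ℕ) : feasibleSum m n ∈ invSector m n := by
  intro g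
  ext x
  rw [symm_apply]
  have h := penalty_invariant g ((g.1.arrowCongr g.2).symm x)
  rw [Equiv.apply_symm_apply] at h
  simp [feasibleSum, feasible, h]

lemma feasibleProj_feasibleSum : feasibleProj m n (feasibleSum m n) = feasibleSum m n := by
  ext x
  rw [feasibleProj_apply]
  simp [feasibleSum]

/-- With as many blocks as symbols, the identity word is a permutation and has penalty zero. -/
lemma feasibleSum_ne_zero (n : ℕ) : feasibleSum n n ≠ 0 := by
  intro h
  have h1 : (id : Fin n → Fin n) ∈ feasible n n := by
    have hc : ∀ k : Fin n, count (id : Fin n → Fin n) k = 1 := fun k =>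
      Finset.card_eq_one.2 ⟨k, by ext b; simp⟩
    exact Finset.mem_filter.2 ⟨Finset.mem_univ _, by simp [penalty, hc]⟩
  have := congrArg (fun ψ : OneHotSpace n n => ψ id) h
  simp [feasibleSum, h1] at this

/-- All coordinates of both vectors are real, so no phase correction is needed before reflecting. -/
lemma inner_initialState_feasibleSum :
    inner ℂ (initialState m n) (feasibleSum m n) = inner ℂ (feasibleSum m n) (initialState m n) := by
  simp only [PiLp.inner_apply, initialState, feasibleSum, RCLike.inner_apply]
  refine Finset.sum_congr rfl fun x _ => ?_
  split_ifs <;> simp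

lemma exists_feasible_target (n : ℕ) : ∃ f : invSector n n, ‖f‖ = 1 ∧
    feasibleProj n n (f : OneHotSpace n n) = f ∧
    inner ℂ (⟨initialState n n, initialState_mem n n⟩ : invSector n n) f =
      inner ℂ f (⟨initialState n n, initialState_mem n n⟩ : invSector n n) := by
  have h0 := norm_ne_zero_iff.2 (feasibleSum_ne_zero n)
  refine ⟨((‖feasibleSum n n‖⁻¹ : ℝ) : ℂ) • ⟨feasibleSum n n, feasibleSum_mem n n⟩, ?_, ?_, ?_⟩
  · rw [norm_smul, Submodule.coe_norm, Complex.norm_real, norm_inv, norm_norm, inv_mul_cancel₀ h0]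
  · rw [Submodule.coe_smul, map_smul, feasibleProj_feasibleSum]
  · rw [Submodule.coe_inner, Submodule.coe_inner, Submodule.coe_smul, inner_smul_left,
      inner_smul_right, Complex.conj_ofReal, inner_initialState_feasibleSum]

end Feasibility

/-- Under the Lie algebra rank condition every feasibility probability below `1` is exceeded at some
positive finite depth. -/
lemma exists_lt_feasProb (n : ℕ)
    (hctrl : LieGeneratesUnitary (E := invSector n n) (opA n n) (opB n n)) {c : ℝ} (hc : c < 1) :
    ∃ p : ℕ, 0 < p ∧ ∃ γ β : Fin p → ℝ, c < feasProb n n γ β := by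
  obtain ⟨f, hf1, hfP, hfr⟩ := exists_feasible_target n
  have hs : ‖(⟨initialState n n, initialState_mem n n⟩ : invSector n n)‖ = ‖f‖ := by
    rw [hf1, Submodule.coe_norm, norm_initialState n n id]
  let q : invSector n n → ℝ := fun ψ =>
    (inner ℂ (ψ : OneHotSpace n n) (feasibleProj n n (ψ : OneHotSpace n n))).re
  have hq : Continuous q := by fun_prop
  have hqf : c < q f := by
    have : q f = 1 := by
      simp only [q]
      rw [hfP, inner_self_eq_norm_sq_to_K, ← Submodule.coe_norm, hf1]
      simp
    rwa [this]
  exact hctrl.exists_alternating_mem hs hfr (isOpen_Ioi.preimage hq) hqf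

end CEQAOA

theorem mainTheorem2 (n : ℕ)
    (hctrl : CEQAOA.LieGeneratesUnitary (E := CEQAOA.invSector n n)
      (CEQAOA.opA n n) (CEQAOA.opB n n)) :
    (∀ η : ℝ, 0 < η → η < 1 →
      ∃ p : ℕ, 0 < p ∧ ∃ γ β : Fin p → ℝ, 1 - η ≤ CEQAOA.feasProb n n γ β) ∧
    (∃ p : ℕ, 0 < p ∧ ∃ γ β : Fin p → ℝ, 1 / 2 ≤ CEQAOA.feasProb n n γ β) := by
  have key := fun c hc => CEQAOA.exists_lt_feasProb n hctrl (c := c) hc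
  refine ⟨fun η hη _ => ?_, ?_⟩
  · obtain ⟨p, hp, γ, β, h⟩ := key (1 - η) (by linarith)
    exact ⟨p, hp, γ, β, h.le⟩
  · obtain ⟨p, hp, γ, β, h⟩ := key (1 / 2) (by norm_num)
    exact ⟨p, hp, γ, β, h.le⟩
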